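/- Let $\mathbb T=\mathbb R\,\cup\,\{a^\nu : a\in\mathbb R\}\,\cup\,\{-\infty\}$ be the extended tropical semiring: it consists of the real numbers, a second (ghost) copy $a^\nu$ of each real number $a$, and $-\infty$. Put $(a^\nu)^\nu=a^\nu$ and $(-\infty)^\nu=-\infty$. Order $\mathbb T$ totally by letting $-\infty$ be the least element, $a\prec b$, $a\prec b^\nu$, $a^\nu\prec b$, $a^\nu\prec b^\nu$ for all real $a<b$, and $a\prec a^\nu$ for all real $a$. Define $x\oplus y=\max_{\prec}\{x,y\}$ if $x\ne y$ and $x\oplus x=x^\nu$; define $a\odot b=a+b$, $a^\nu\odot b=a\odot b^\nu=a^\nu\odot b^\nu=(a+b)^\nu$ for $a,b\in\mathbb R$, and $x\odot(-\infty)=(-\infty)\odot x=-\infty$ for all $x\in\mathbb T$. Write $\overline{\mathbb R}=\mathbb R\cup\{-\infty\}$ and $\overline{\mathbb U}=\{a^\nu:a\in\mathbb R\}\cup\{-\infty\}$. Vectors $v_1,\dots,v_m\in\mathbb T^{(n)}$ are tropically dependent if there are $\alpha_1,\dots,\alpha_m\in\overline{\mathbb R}$, not all $-\infty$, such that every entry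 of $\alpha_1 v_1\oplus\cdots\oplus\alpha_m v_m$ lies in $\overline{\mathbb U}$; otherwise they are tropically independent. The tropical rank of a matrix over $\mathbb T$ is the maximal number of tropically independent rows. The tropical determinant of an $n\times n$ matrix $A=(a_{i,j})$ over $\mathbb T$ is $|A|=\bigoplus_{\sigma\in S_n} a_{1,\sigma(1)}\odot\cdots\odot a_{n,\sigma(n)}$, and $A$ is tropically singular if $|A|\in\overline{\mathbb U}$. Theorem. An $n\times n$ matrix $A$ over $\mathbb T$ has tropical rank $<n$ if and only if $A$ is tropically singular. -/

import Mathlib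

/-- The extended tropical semiring as a set: two copies of `ℝ`, the real part (`real a`) and the
ghost part (`ghost a`, written `a^ν`), each enlarged by `-∞` and glued along `-∞` (`negInf`). -/
inductive ExtTrop : Type
  | negInf : ExtTrop
  | real (a : ℝ) : ExtTrop
  | ghost (a : ℝ) : ExtTrop

namespace ExtTrop

/-- The ghost map `ν`: `a ↦ a^ν`, `a^ν ↦ a^ν`, `-∞ ↦ -∞`. -/
def nu : ExtTrop → ExtTrop
  | negInf => negInf
  | real a => ghost a
  | ghost a => ghost a

/-- The strict order `≺`: `-∞` is the least element, elements with distinct underlying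
real numbers are ordered by these numbers, and `a ≺ a^ν`. -/
def prec : ExtTrop → ExtTrop → Prop
  | negInf, negInf => False
  | negInf, real _ => True
  | negInf, ghost _ => True
  | real _, negInf => False
  | ghost _, negInf => False
  | real a, real b => a < b
  | real a, ghost b => a ≤ b
  | ghost a, real b => a < b
  | ghost a, ghost b => a < b

open Classical in
/-- Tropical addition: the `≺`-maximum of two distinct elements, and `x ⊕ x = x^ν`
(in particular `-∞ ⊕ -∞ = -∞`). -/
noncomputable def add (x y : ExtTrop) : ExtTrop :=
  if x = y then nu x else if prec x y then y else x

/-- Tropical multiplication: addition of the underlying reals; a product with a ghost factor is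
ghost, a product with a factor `-∞` is `-∞`. -/
noncomputable def mul : ExtTrop → ExtTrop → ExtTrop
  | negInf, _ => negInf
  | real _, negInf => negInf
  | ghost _, negInf => negInf
  | real a, real b => real (a + b)
  | real a, ghost b => ghost (a + b)
  | ghost a, real b => ghost (a + b)
  | ghost a, ghost b => ghost (a + b)

theorem negInf_add' (x : ExtTrop) : add negInf x = x := by
  cases x <;> simp [add, prec, nu]

theorem add_negInf' (x : ExtTrop) : add x negInf = x := by
  cases x <;> simp [add, prec, nu]

theorem add_real_real (a b : ℝ) :
    add (real a) (real b) = if a = b then ghost a else if a < b then real b else real a := by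
  simp only [add, prec, nu, real.injEq]
  grind

theorem add_real_ghost (a b : ℝ) :
    add (real a) (ghost b) = if a ≤ b then ghost b else real a := by
  simp only [add, prec, reduceCtorEq, if_false]
  grind

theorem add_ghost_real (a b : ℝ) :
    add (ghost a) (real b) = if a < b then real b else ghost a := by
  simp only [add, prec, reduceCtorEq, if_false]
  grind

theorem add_ghost_ghost (a b : ℝ) :
    add (ghost a) (ghost b) = if a < b then ghost b else ghost a := by
  simp only [add, prec, nu, ghost.injEq]
  grind

theorem add_comm' (x y : ExtTrop) : add x y = add y x := by
  cases x <;> cases y <;> simp only [negInf_add', add_negInf', add_real_real, add_real_ghost,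
    add_ghost_real, add_ghost_ghost] <;> grind

theorem add_assoc' (x y z : ExtTrop) : add (add x y) z = add x (add y z) := by
  cases x <;> cases y <;> cases z <;> simp only [negInf_add', add_negInf', add_real_real,
    add_real_ghost, add_ghost_real, add_ghost_ghost] <;> split_ifs <;>
    simp only [add_real_real, add_real_ghost, add_ghost_real, add_ghost_ghost] <;> grind

theorem mul_comm' (x y : ExtTrop) : mul x y = mul y x := by
  cases x <;> cases y <;> simp [mul, add_comm]

theorem mul_assoc' (x y z : ExtTrop) : mul (mul x y) z = mul x (mul y z) := by
  cases x <;> cases y <;> cases z <;> simp [mul, add_assoc]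

theorem mul_add' (x y z : ExtTrop) : mul x (add y z) = add (mul x y) (mul x z) := by
  cases x <;> cases y <;> cases z <;> simp only [mul, negInf_add', add_negInf', add_real_real,
    add_real_ghost, add_ghost_real, add_ghost_ghost] <;> grind [mul]

noncomputable instance : Add ExtTrop := ⟨add⟩

noncomputable instance : Mul ExtTrop := ⟨mul⟩

instance : Zero ExtTrop := ⟨negInf⟩

noncomputable instance : One ExtTrop := ⟨real 0⟩

/-- The commutative semiring `(𝕋, ⊕, ⊙)`. Its zero `0` is `-∞`, and its unit `1` is the real
number `0`. -/
noncomputable instance instCommSemiring : CommSemiring ExtTrop where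
  add_assoc := add_assoc'
  add_comm := add_comm'
  zero_add := negInf_add'
  add_zero := add_negInf'
  mul_assoc := mul_assoc'
  mul_comm := mul_comm'
  one_mul x := by
    change mul (real 0) x = x
    cases x <;> simp [mul]
  mul_one x := by
    change mul x (real 0) = x
    cases x <;> simp [mul]
  zero_mul x := by
    change mul negInf x = negInf
    cases x <;> rfl
  mul_zero x := by
    change mul x negInf = negInf
    cases x <;> rfl
  nsmul := nsmulRec
  left_distrib := mul_add'
  right_distrib x y z := by
    change mul (add x y) z = add (mul x z) (mul y z)
    rw [mul_comm', mul_add', mul_comm' z x, mul_comm' z y]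

/-- The set `ℝ ∪ {-∞}` of elements that are real or `-∞`. -/
def realBar : Set ExtTrop := {x | x = negInf ∨ ∃ a : ℝ, x = real a}

/-- The set of elements that are ghost or `-∞`. -/
def ghostBar : Set ExtTrop := {x | x = negInf ∨ ∃ a : ℝ, x = ghost a}

/-- A ghost vector: every entry is ghost or `-∞`. -/
def IsGhostVector {κ : Type*} (v : κ → ExtTrop) : Prop := ∀ j, v j ∈ ghostBar

/-- A finite family of vectors is tropically dependent if some combination of them, with
coefficients in `ℝ ∪ {-∞}` that are not all `-∞`, is a ghost vector. -/
def TropDependent {ι κ : Type*} [Fintype ι] (v : ι → κ → ExtTrop) : Prop :=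
  ∃ α : ι → ExtTrop, (∀ i, α i ∈ realBar) ∧ (∃ i, α i ≠ negInf) ∧
    IsGhostVector (∑ i, α i • v i)

/-- Tropically independent means not tropically dependent. -/
def TropIndependent {ι κ : Type*} [Fintype ι] (v : ι → κ → ExtTrop) : Prop :=
  ¬ TropDependent v

open Classical in
/-- The tropical rank: the maximal number of tropically independent rows. -/
noncomputable def tropRank {m n : ℕ} (A : Matrix (Fin m) (Fin n) ExtTrop) : ℕ :=
  (Finset.univ.filter fun s : Finset (Fin m) => TropIndependent fun i : s => A.row i).sup
    Finset.card

/-- The tropical determinant `|A| = ⨁_σ a_{1,σ(1)} ⋯ a_{n,σ(n)}`. -/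
noncomputable def tropDet {n : ℕ} (A : Matrix (Fin n) (Fin n) ExtTrop) : ExtTrop :=
  ∑ σ : Equiv.Perm (Fin n), ∏ i, A i (σ i)

/-- `A` is tropically singular if its tropical determinant is ghost or `-∞`. -/
def TropSingular {n : ℕ} (A : Matrix (Fin n) (Fin n) ExtTrop) : Prop :=
  tropDet A ∈ ghostBar

end ExtTrop

/-! Through `val`, sums become maxima in `ℝ≥0`, and a sum is ghost or `-∞` exactly when each
non-ghost term is matched by another term of at least its value (`sum_mem_ghostBar_iff`). Dependence
and singularity thus become max-times inequalities.

Dependence gives singularity (`exists_perm_prod_le`): if `σ` picks no ghost or `-∞` entry, send each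
row `i` in the support of `α` to a row dominating it in column `σ i`. This self-map has a cycle, and
rerouting `σ` along its cycles gives another permutation with no smaller product.

Conversely, as in Cramer's rule, the cofactors along a column `j₀` serve as coefficients. Exchanging
two rows settles the other columns (`exists_cofactor_mul_le`); `j₀` is chosen by means of an optimal
permutation. If all products vanish, the cofactors may vanish too, and
`exists_relation_of_prod_eq_zero` works instead with a matchable set of rows and one row that spoils
it. -/

open scoped NNReal

namespace ExtTrop

/-! ### Values and ghost sums -/

/-- The exponential of the underlying real number, with `-∞ ↦ 0`, as a multiplicative map. -/
noncomputable def val : ExtTrop →* ℝ≥0 where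
  toFun
    | negInf => 0
    | real a => Real.toNNReal (Real.exp a)
    | ghost a => Real.toNNReal (Real.exp a)
  map_one' := by
    change Real.toNNReal (Real.exp 0) = 1
    simp
  map_mul' x y := by
    change _ = (_ : ℝ≥0) * _
    cases x <;> cases y <;>
      simp [HMul.hMul, Mul.mul, mul] <;>
      first
        | rfl
        | exact (congrArg Real.toNNReal (Real.exp_add _ _)).trans
            (Real.toNNReal_mul (Real.exp_nonneg _))
        | exact (zero_mul _).symm
        | exact (mul_zero _).symm

theorem val_negInf : val negInf = 0 := rfl

theorem val_real (a : ℝ) : val (real a) = Real.toNNReal (Real.exp a) := rfl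

theorem val_ghost (a : ℝ) : val (ghost a) = Real.toNNReal (Real.exp a) := rfl

theorem toNNReal_exp_le_iff (a b : ℝ) :
    Real.toNNReal (Real.exp a) ≤ Real.toNNReal (Real.exp b) ↔ a ≤ b := by
  rw [Real.toNNReal_le_toNNReal_iff (Real.exp_nonneg _), Real.exp_le_exp]

theorem toNNReal_exp_pos (a : ℝ) : 0 < Real.toNNReal (Real.exp a) :=
  Real.toNNReal_pos.2 (Real.exp_pos a)

theorem val_eq_zero_iff {x : ExtTrop} : val x = 0 ↔ x = negInf := by
  cases x <;> simp [val_negInf, val_real, val_ghost, Real.exp_pos]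

theorem negInf_mem_ghostBar : negInf ∈ ghostBar := Or.inl rfl

theorem ghost_mem_ghostBar (a : ℝ) : ghost a ∈ ghostBar := Or.inr ⟨a, rfl⟩

theorem real_notMem_ghostBar (a : ℝ) : real a ∉ ghostBar := by
  rintro (h | ⟨b, h⟩) <;> cases h

theorem val_pos_of_notMem_ghostBar {x : ExtTrop} (hx : x ∉ ghostBar) : 0 < val x := by
  rw [pos_iff_ne_zero, Ne, val_eq_zero_iff]
  rintro rfl
  exact hx negInf_mem_ghostBar

theorem mul_mem_ghostBar_iff {x y : ExtTrop} :
    x * y ∈ ghostBar ↔ x ∈ ghostBar ∨ y ∈ ghostBar := by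
  change mul x y ∈ ghostBar ↔ _
  cases x <;> cases y <;>
    simp [mul, negInf_mem_ghostBar, ghost_mem_ghostBar, real_notMem_ghostBar]

theorem prod_mem_ghostBar_iff {ι : Type*} (s : Finset ι) (x : ι → ExtTrop) :
    ∏ i ∈ s, x i ∈ ghostBar ↔ ∃ i ∈ s, x i ∈ ghostBar := by
  classical
  induction s using Finset.induction_on with
  | empty =>
    rw [Finset.prod_empty]
    exact iff_of_false (real_notMem_ghostBar 0) (by simp)
  | insert a s ha ih => simp [Finset.prod_insert ha, mul_mem_ghostBar_iff, ih]

theorem val_add (x y : ExtTrop) : val (x + y) = max (val x) (val y) := by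
  change val (add x y) = _
  cases x <;> cases y <;>
    simp only [negInf_add', add_negInf', add_real_real, add_real_ghost, add_ghost_real,
      add_ghost_ghost] <;>
    try split_ifs
  all_goals
    simp only [val_negInf, val_real, val_ghost, max_self, zero_le, max_eq_left, max_eq_right]
  all_goals
    symm
    first
      | (rw [max_eq_left_iff, toNNReal_exp_le_iff]; linarith)
      | (rw [max_eq_right_iff, toNNReal_exp_le_iff]; linarith)

theorem add_mem_ghostBar_iff (x y : ExtTrop) :
    x + y ∈ ghostBar ↔ (x ∈ ghostBar ∨ val x ≤ val y) ∧ (y ∈ ghostBar ∨ val y ≤ val x) := by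
  change add x y ∈ ghostBar ↔ _
  cases x <;> cases y <;>
    simp only [negInf_add', add_negInf', add_real_real, add_real_ghost, add_ghost_real,
      add_ghost_ghost] <;>
    try split_ifs
  all_goals
    simp only [val_negInf, val_real, val_ghost, negInf_mem_ghostBar, ghost_mem_ghostBar,
      real_notMem_ghostBar, toNNReal_exp_le_iff, (toNNReal_exp_pos _).not_ge, le_refl,
      true_or, false_or, or_false, and_true, and_self, and_false, true_iff, false_iff,
      zero_le]
  all_goals grind

theorem val_sum {ι : Type*} (s : Finset ι) (x : ι → ExtTrop) :
    val (∑ i ∈ s, x i) = s.sup fun i => val (x i) := by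
  classical
  induction s using Finset.induction_on with
  | empty => exact val_negInf
  | insert a s ha ih => rw [Finset.sum_insert ha, val_add, ih, Finset.sup_insert]

/-- A sum lies in `ghostBar` iff no single non-ghost summand strictly dominates the others. -/
theorem sum_mem_ghostBar_iff {ι : Type*} (s : Finset ι) (x : ι → ExtTrop) :
    ∑ i ∈ s, x i ∈ ghostBar ↔
      ∀ i ∈ s, x i ∈ ghostBar ∨ ∃ k ∈ s, k ≠ i ∧ val (x i) ≤ val (x k) := by
  classical
  induction s using Finset.induction_on with
  | empty => exact iff_of_true negInf_mem_ghostBar (by simp)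
  | insert a s ha ih =>
    rw [Finset.sum_insert ha, add_mem_ghostBar_iff, ih, val_sum, Finset.sup_le_iff]
    constructor
    · rintro ⟨h1, h2⟩ i hi
      rcases Finset.mem_insert.1 hi with rfl | hi
      · by_cases hg : x i ∈ ghostBar
        · exact Or.inl hg
        · obtain ⟨k, hk, hle⟩ :=
            (Finset.le_sup_iff (val_pos_of_notMem_ghostBar hg)).1 (h1.resolve_left hg)
          exact Or.inr ⟨k, Finset.mem_insert_of_mem hk, fun h => ha (h ▸ hk), hle⟩
      · rcases h2 with h2 | h2
        · exact (h2 i hi).imp_right fun ⟨k, hk, h⟩ => ⟨k, Finset.mem_insert_of_mem hk, h⟩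
        · exact Or.inr ⟨a, Finset.mem_insert_self _ _, fun h => ha (h ▸ hi), h2 i hi⟩
    · intro h
      refine ⟨?_, ?_⟩
      · refine (h a (Finset.mem_insert_self _ _)).imp_right fun ⟨k, hk, hne, hle⟩ => ?_
        exact hle.trans
          (Finset.le_sup (f := fun i => val (x i)) (Finset.mem_of_mem_insert_of_ne hk hne))
      · by_cases hall : ∀ b ∈ s, val (x b) ≤ val (x a)
        · exact Or.inr hall
        · push Not at hall
          obtain ⟨b, hb, hlt⟩ := hall
          refine Or.inl fun i hi => ?_
          refine (h i (Finset.mem_insert_of_mem hi)).imp_right fun ⟨k, hk, hne, hle⟩ => ?_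
          -- If the dominating term is the new one, `b` exceeds it and takes its place.
          rcases Finset.mem_insert.1 hk with rfl | hk
          · exact ⟨b, hb, fun e => (hle.trans_lt hlt).ne (by rw [e]), (hle.trans_lt hlt).le⟩
          · exact ⟨k, hk, hne, hle⟩

/-- The element of `ℝ ∪ {-∞}` with given value. -/
noncomputable def ofVal (r : ℝ≥0) : ExtTrop := if r = 0 then negInf else real (Real.log r)

theorem ofVal_mem_realBar (r : ℝ≥0) : ofVal r ∈ realBar := by
  unfold ofVal
  split_ifs
  · exact Or.inl rfl
  · exact Or.inr ⟨_, rfl⟩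

theorem val_ofVal (r : ℝ≥0) : val (ofVal r) = r := by
  unfold ofVal
  split_ifs with h
  · rw [h, val_negInf]
  · rw [val_real, Real.exp_log (NNReal.coe_pos.2 (pos_iff_ne_zero.2 h)), Real.toNNReal_coe]

theorem mem_ghostBar_iff_of_mem_realBar {x : ExtTrop} (hx : x ∈ realBar) :
    x ∈ ghostBar ↔ val x = 0 := by
  rw [val_eq_zero_iff]
  rcases hx with rfl | ⟨a, rfl⟩
  · simp [negInf_mem_ghostBar]
  · simp [real_notMem_ghostBar]

/-- Tropical dependence in terms of the values of the coefficients and of the entries. -/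
theorem tropDependent_iff {ι κ : Type*} [Fintype ι] (v : ι → κ → ExtTrop) :
    TropDependent v ↔ ∃ α : ι → ℝ≥0, (∃ i, α i ≠ 0) ∧ ∀ j i, α i = 0 ∨ v i j ∈ ghostBar ∨
      ∃ k, k ≠ i ∧ α i * val (v i j) ≤ α k * val (v k j) := by
  have key (α : ι → ExtTrop) (hα : ∀ i, α i ∈ realBar) :
      IsGhostVector (∑ i, α i • v i) ↔ ∀ j i, val (α i) = 0 ∨ v i j ∈ ghostBar ∨
        ∃ k, k ≠ i ∧ val (α i) * val (v i j) ≤ val (α k) * val (v k j) := by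
    refine forall_congr' fun j => ?_
    rw [Finset.sum_apply, sum_mem_ghostBar_iff]
    simp [mul_mem_ghostBar_iff, mem_ghostBar_iff_of_mem_realBar (hα _), or_assoc]
  constructor
  · rintro ⟨α, hα, ⟨i, hi⟩, h⟩
    exact ⟨fun i => val (α i), ⟨i, mt val_eq_zero_iff.1 hi⟩, (key α hα).1 h⟩
  · rintro ⟨α, ⟨i, hi⟩, h⟩
    refine ⟨fun i => ofVal (α i), fun i => ofVal_mem_realBar _, ⟨i, fun e => hi ?_⟩, ?_⟩
    · exact (val_ofVal (α i)).symm.trans (val_eq_zero_iff.2 e)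
    · rw [key _ fun i => ofVal_mem_realBar _]
      simpa only [val_ofVal] using h

/-! ### Dependence implies singularity -/

/-- A self-map of a finite type agrees on its periodic points with a permutation that fixes all
other points. -/
theorem exists_perm_eq_on_periodicPts {ι : Type*} [Finite ι] (f : ι → ι) :
    ∃ g : Equiv.Perm ι, (∀ i ∈ Function.periodicPts f, g i = f i) ∧
      ∀ i ∉ Function.periodicPts f, g i = i := by
  classical
  have hb := Function.bijOn_periodicPts f
  have hinj : Function.Injective fun i => if i ∈ Function.periodicPts f then f i else i := by
    intro a b hab
    by_cases ha : a ∈ Function.periodicPts f <;> by_cases hb' : b ∈ Function.periodicPts f <;>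
      simp only [ha, hb', if_true, if_false] at hab
    · exact hb.injOn ha hb' hab
    · exact absurd (hab ▸ hb.mapsTo ha) hb'
    · exact absurd (hab ▸ hb.mapsTo hb') ha
    · exact hab
  refine ⟨Equiv.ofBijective _ (Finite.injective_iff_bijective.1 hinj), fun i hi => ?_,
    fun i hi => ?_⟩
  · exact if_pos hi
  · exact if_neg hi

/-- If each row of the support of `α` is matched by `σ` to a column in which it is dominated by
another row, then some other permutation has at least the same product. -/
theorem exists_perm_prod_le {ι κ : Type*} [Fintype ι] (w : ι → κ → ℝ≥0)
    (σ : ι ≃ κ) (hσ : ∀ i, w i (σ i) ≠ 0) (α : ι → ℝ≥0) (hα : ∃ i, α i ≠ 0)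
    (h : ∀ i, α i ≠ 0 → ∃ k, k ≠ i ∧ α i * w i (σ i) ≤ α k * w k (σ i)) :
    ∃ τ : ι ≃ κ, τ ≠ σ ∧ ∏ i, w i (σ i) ≤ ∏ i, w i (τ i) := by
  classical
  -- `f` sends a support row to a dominating row, again in the support, and fixes all other rows.
  have h' : ∀ i, ∃ k, (α i ≠ 0 → k ≠ i ∧ α k ≠ 0 ∧ α i * w i (σ i) ≤ α k * w k (σ i)) ∧
      (α i = 0 → k = i) := by
    intro i
    by_cases hi : α i = 0
    · exact ⟨i, fun h => absurd hi h, fun _ => rfl⟩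
    · obtain ⟨k, hk, hle⟩ := h i hi
      refine ⟨k, fun _ => ⟨hk, fun h0 => ?_, hle⟩, fun h => absurd h hi⟩
      rw [h0, zero_mul] at hle
      exact mul_ne_zero hi (hσ i) (le_antisymm hle zero_le)
  choose f hf hf0 using h'
  obtain ⟨g, hg, hg'⟩ := exists_perm_eq_on_periodicPts f
  obtain ⟨p, hp, hper⟩ : ∃ p, α p ≠ 0 ∧ p ∈ Function.periodicPts f := by
    obtain ⟨i, hi⟩ := hα
    have hit : ∀ m, α (f^[m] i) ≠ 0 := by
      intro m
      induction m with
      | zero => exact hi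
      | succ m ih =>
        rw [Function.iterate_succ_apply']
        exact (hf _ ih).2.1
    obtain ⟨a, b, hab, he⟩ := Finite.exists_ne_map_eq_of_infinite fun m : ℕ => f^[m] i
    wlog hlt : a < b generalizing a b
    · exact this b a hab.symm he.symm (lt_of_le_of_ne (not_lt.1 hlt) hab.symm)
    refine ⟨f^[a] i, hit a, Function.mk_mem_periodicPts (Nat.sub_pos_of_lt hlt) ?_⟩
    change f^[b - a] (f^[a] i) = f^[a] i
    rw [← Function.iterate_add_apply, Nat.sub_add_cancel hlt.le]
    exact he.symm
  refine ⟨g.symm.trans σ, fun e => ?_, ?_⟩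
  · have := congrArg (fun τ => τ (g p)) e
    simp only [Equiv.trans_apply, Equiv.symm_apply_apply, EmbeddingLike.apply_eq_iff_eq] at this
    exact (hf p hp).1 ((hg p hper).symm.trans this.symm)
  -- Zeros of `α` become 1 so that the product of the coefficients can be cancelled; this is
  -- harmless because `g` fixes those rows.
  · let β : ι → ℝ≥0 := fun i => if α i = 0 then 1 else α i
    have hβ : ∀ i, β i ≠ 0 := fun i => by
      simp only [β]
      split_ifs with h0
      · exact one_ne_zero
      · exact h0
    have hle : ∀ i, β i * w i (σ i) ≤ β (g i) * w (g i) (σ i) := by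
      intro i
      by_cases hi : i ∈ Function.periodicPts f
      · by_cases h0 : α i = 0
        · rw [hg i hi, hf0 i h0]
        · obtain ⟨-, h1, h2⟩ := hf i h0
          simpa only [hg i hi, β, if_neg h0, if_neg h1] using h2
      · rw [hg' i hi]
    have hprod := Finset.prod_le_prod' fun i (_ : i ∈ Finset.univ) => hle i
    rw [Finset.prod_mul_distrib, Finset.prod_mul_distrib, Equiv.prod_comp g β] at hprod
    have hre : ∏ i, w (g i) (σ i) = ∏ i, w i ((g.symm.trans σ) i) := by
      rw [← Equiv.prod_comp g fun i => w i ((g.symm.trans σ) i)]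
      simp
    rw [hre] at hprod
    exact le_of_mul_le_mul_left hprod
      (pos_iff_ne_zero.2 (Finset.prod_ne_zero_iff.2 fun i _ => hβ i))

theorem tropSingular_iff {n : ℕ} (A : Matrix (Fin n) (Fin n) ExtTrop) :
    TropSingular A ↔ ∀ σ : Equiv.Perm (Fin n), (∃ i, A i (σ i) ∈ ghostBar) ∨
      ∃ τ, τ ≠ σ ∧ ∏ i, val (A i (σ i)) ≤ ∏ i, val (A i (τ i)) := by
  simp [TropSingular, tropDet, sum_mem_ghostBar_iff, prod_mem_ghostBar_iff, map_prod]

theorem tropSingular_of_tropDependent {n : ℕ} {A : Matrix (Fin n) (Fin n) ExtTrop}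
    (h : TropDependent fun i => A i) : TropSingular A := by
  rw [tropSingular_iff]
  intro σ
  by_cases hg : ∃ i, A i (σ i) ∈ ghostBar
  · exact Or.inl hg
  · push Not at hg
    obtain ⟨α, hα, hdep⟩ := (tropDependent_iff _).1 h
    exact Or.inr (exists_perm_prod_le (fun i j => val (A i j)) σ
      (fun i => (val_pos_of_notMem_ghostBar (hg i)).ne') α hα fun i hi =>
        ((hdep (σ i) i).resolve_left hi).resolve_left (hg i))

/-! ### Max-times cofactors -/

section Cofactor

variable {ι : Type*} [Fintype ι] [DecidableEq ι]

/-- The max-times cofactor of `w` at row `i` and column `j`. -/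
def cofactor (w : ι → ι → ℝ≥0) (j i : ι) : ℝ≥0 :=
  (Finset.univ.filter fun σ : Equiv.Perm ι => σ i = j).sup
    fun σ => ∏ k ∈ Finset.univ.erase i, w k (σ k)

theorem prod_erase_le_cofactor (w : ι → ι → ℝ≥0) {j i : ι} {σ : Equiv.Perm ι} (h : σ i = j) :
    ∏ k ∈ Finset.univ.erase i, w k (σ k) ≤ cofactor w j i :=
  Finset.le_sup (f := fun σ : Equiv.Perm ι => ∏ k ∈ Finset.univ.erase i, w k (σ k))
    (Finset.mem_filter.2 ⟨Finset.mem_univ σ, h⟩)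

theorem exists_cofactor_eq (w : ι → ι → ℝ≥0) (j i : ι) :
    ∃ σ : Equiv.Perm ι, σ i = j ∧ cofactor w j i = ∏ k ∈ Finset.univ.erase i, w k (σ k) := by
  obtain ⟨σ, hσ, he⟩ := Finset.exists_mem_eq_sup
    (Finset.univ.filter fun σ : Equiv.Perm ι => σ i = j)
    ⟨Equiv.swap i j, Finset.mem_filter.2 ⟨Finset.mem_univ _, Equiv.swap_apply_left i j⟩⟩
    fun σ => ∏ k ∈ Finset.univ.erase i, w k (σ k)
  exact ⟨σ, (Finset.mem_filter.1 hσ).2, he⟩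

theorem exists_cofactor_mul_eq (w : ι → ι → ℝ≥0) (j i : ι) :
    ∃ σ : Equiv.Perm ι, σ i = j ∧ cofactor w j i * w i j = ∏ k, w k (σ k) := by
  obtain ⟨σ, hσ, he⟩ := exists_cofactor_eq w j i
  refine ⟨σ, hσ, ?_⟩
  rw [he, ← Finset.prod_erase_mul _ _ (Finset.mem_univ i), hσ]

theorem prod_le_cofactor_mul (w : ι → ι → ℝ≥0) {j i : ι} {σ : Equiv.Perm ι} (h : σ i = j) :
    ∏ k, w k (σ k) ≤ cofactor w j i * w i j := by
  rw [← Finset.prod_erase_mul _ _ (Finset.mem_univ i), h]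
  exact mul_le_mul_left (prod_erase_le_cofactor w h) _

/-- The cofactors along column `j₀` satisfy the tropical relation given by any other column. -/
theorem exists_cofactor_mul_le (w : ι → ι → ℝ≥0) {j₀ j : ι} (hj : j ≠ j₀) (i : ι) :
    ∃ k, k ≠ i ∧ cofactor w j₀ i * w i j ≤ cofactor w j₀ k * w k j := by
  obtain ⟨σ, hσ, he⟩ := exists_cofactor_eq w j₀ i
  have hk : σ.symm j ≠ i := fun h => hj (by rw [← hσ, ← h, Equiv.apply_symm_apply])
  have hσk : σ (σ.symm j) = j := σ.apply_symm_apply j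
  generalize σ.symm j = k at hk hσk
  refine ⟨k, hk, ?_⟩
  -- Row `k` holds column `j` under `σ`. After the swap `i` takes `j` and `k` takes `j₀`, so both
  -- sides contain `w i j * w k j` and the same remaining factors.
  have hle := prod_erase_le_cofactor w (j := j₀) (i := k) (σ := (Equiv.swap i k).trans σ)
    (by simp [hσ])
  refine le_trans (le_of_eq ?_) (mul_le_mul_left hle _)
  rw [he, ← Finset.mul_prod_erase (Finset.univ.erase i) _
      (Finset.mem_erase.2 ⟨hk, Finset.mem_univ k⟩),
    ← Finset.mul_prod_erase (Finset.univ.erase k) _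
      (Finset.mem_erase.2 ⟨hk.symm, Finset.mem_univ i⟩), Finset.erase_right_comm]
  have hrest : ∏ l ∈ (Finset.univ.erase k).erase i, w l (((Equiv.swap i k).trans σ) l) =
      ∏ l ∈ (Finset.univ.erase k).erase i, w l (σ l) := by
    refine Finset.prod_congr rfl fun l hl => ?_
    simp only [Finset.mem_erase] at hl
    rw [Equiv.trans_apply, Equiv.swap_apply_of_ne_of_ne hl.1 hl.2.1]
  rw [hrest, Equiv.trans_apply, Equiv.swap_apply_left, hσk]
  ring

end Cofactor

/-! ### Singularity implies dependence -/

/-- If all permutation products vanish, some nonzero `α` satisfies all relations by domination. -/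
theorem exists_relation_of_prod_eq_zero {ι : Type*} [Fintype ι] (w : ι → ι → ℝ≥0)
    (h : ∀ σ : Equiv.Perm ι, ∏ i, w i (σ i) = 0) :
    ∃ α : ι → ℝ≥0, (∃ i, α i ≠ 0) ∧ ∀ j i, α i = 0 ∨ w i j = 0 ∨
      ∃ k, k ≠ i ∧ α i * w i j ≤ α k * w k j := by
  classical
  obtain ⟨S, i₀, ⟨σ₀, hσ₀⟩, hS⟩ : ∃ (S : Finset ι) (i₀ : ι),
      (∃ σ : Equiv.Perm ι, ∀ k ∈ S, w k (σ k) ≠ 0) ∧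
      ¬ ∃ σ : Equiv.Perm ι, ∀ k ∈ insert i₀ S, w k (σ k) ≠ 0 := by
    by_contra hcon
    have hall : ∀ S : Finset ι, ∃ σ : Equiv.Perm ι, ∀ k ∈ S, w k (σ k) ≠ 0 := by
      intro S
      induction S using Finset.induction_on with
      | empty => exact ⟨1, by simp⟩
      | insert a s _ ih =>
        by_contra hno
        exact hcon ⟨s, a, ih, hno⟩
    obtain ⟨σ, hσ⟩ := hall Finset.univ
    exact Finset.prod_ne_zero_iff.2 hσ (h σ)
  -- Rows outside `insert i₀ S` become rows of the permutation matrix of `σ₀`. This makes the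
  -- cofactor at `i₀` nonzero; cofactors at the replaced rows vanish, since a nonzero one would
  -- match all of `insert i₀ S`.
  let u : ι → ι → ℝ≥0 := fun k j =>
    if k ∈ insert i₀ S then w k j else if j = σ₀ k then 1 else 0
  have hu : ∀ k ∈ insert i₀ S, u k = w k := fun k hk => funext fun j => if_pos hk
  have hout : ∀ i ∉ insert i₀ S, cofactor u (σ₀ i₀) i = 0 := by
    intro i hi
    by_contra hne
    obtain ⟨σ, -, he⟩ := exists_cofactor_eq u (σ₀ i₀) i
    rw [he, ← Ne, Finset.prod_ne_zero_iff] at hne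
    refine hS ⟨σ, fun k hk => ?_⟩
    rw [← hu k hk]
    exact hne k (Finset.mem_erase.2 ⟨fun e => hi (e ▸ hk), Finset.mem_univ k⟩)
  refine ⟨cofactor u (σ₀ i₀), ⟨i₀, ?_⟩, fun j i => ?_⟩
  · refine ne_of_gt (lt_of_lt_of_le (pos_iff_ne_zero.2 ?_)
      (prod_erase_le_cofactor u (σ := σ₀) rfl))
    refine Finset.prod_ne_zero_iff.2 fun k hk => ?_
    by_cases hkS : k ∈ S
    · rw [hu k (Finset.mem_insert_of_mem hkS)]
      exact hσ₀ k hkS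
    · have : k ∉ insert i₀ S := by simp [(Finset.mem_erase.1 hk).1, hkS]
      exact ne_of_eq_of_ne ((if_neg this).trans (if_pos rfl)) one_ne_zero
  · by_cases h0 : cofactor u (σ₀ i₀) i = 0
    · exact Or.inl h0
    right
    have hi : i ∈ insert i₀ S := by_contra fun hi => h0 (hout i hi)
    by_cases hw : w i j = 0
    · exact Or.inl hw
    right
    have hij : cofactor u (σ₀ i₀) i * w i j ≠ 0 := mul_ne_zero h0 hw
    rw [← hu i hi] at hij ⊢
    have hj : j ≠ σ₀ i₀ := by
      rintro rfl
      obtain ⟨σ, -, he⟩ := exists_cofactor_mul_eq u (σ₀ i₀) i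
      rw [he, Finset.prod_ne_zero_iff] at hij
      exact hS ⟨σ, fun k hk => hu k hk ▸ hij k (Finset.mem_univ k)⟩
    obtain ⟨k, hk, hle⟩ := exists_cofactor_mul_le u hj i
    have hkS : k ∈ insert i₀ S := by
      by_contra hkS
      rw [hout k hkS, zero_mul] at hle
      exact hij (le_antisymm hle zero_le)
    exact ⟨k, hk, by rwa [← hu k hkS]⟩

theorem tropDependent_of_tropSingular {n : ℕ} {A : Matrix (Fin n) (Fin n) ExtTrop}
    (h : TropSingular A) : TropDependent fun i => A i := by
  rw [tropSingular_iff] at h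
  rw [tropDependent_iff]
  let w : Fin n → Fin n → ℝ≥0 := fun i j => val (A i j)
  obtain ⟨σ, hmax⟩ := Finite.exists_max fun σ : Equiv.Perm (Fin n) => ∏ i, w i (σ i)
  by_cases h0 : ∏ i, w i (σ i) = 0
  · obtain ⟨α, hα, hrel⟩ := exists_relation_of_prod_eq_zero w fun τ =>
      le_antisymm ((hmax τ).trans h0.le) zero_le
    refine ⟨α, hα, fun j i => (hrel j i).imp_right (Or.imp_left fun hw => ?_)⟩
    exact val_eq_zero_iff.1 hw ▸ negInf_mem_ghostBar
  have hcol (j₀ i : Fin n) : cofactor w j₀ i * w i j₀ ≤ ∏ i, w i (σ i) := by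
    obtain ⟨τ, -, he⟩ := exists_cofactor_mul_eq w j₀ i
    exact he ▸ hmax τ
  have hne (j₀ : Fin n) : ∃ i, cofactor w j₀ i ≠ 0 := by
    refine ⟨σ.symm j₀, fun hc => h0 (le_antisymm ?_ zero_le)⟩
    simpa [hc] using prod_le_cofactor_mul w (σ.apply_symm_apply j₀)
  -- Only column `j₀` needs care: its terms never exceed the optimal product, so each non-ghost
  -- entry needs another row attaining it.
  have main (j₀ : Fin n) (hj₀ : ∀ i, A i j₀ ∈ ghostBar ∨
      ∃ k, k ≠ i ∧ ∏ i, w i (σ i) ≤ cofactor w j₀ k * w k j₀) :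
      ∃ α : Fin n → ℝ≥0, (∃ i, α i ≠ 0) ∧ ∀ j i, α i = 0 ∨ A i j ∈ ghostBar ∨
        ∃ k, k ≠ i ∧ α i * val (A i j) ≤ α k * val (A k j) := by
    refine ⟨cofactor w j₀, hne j₀, fun j i => Or.inr ?_⟩
    by_cases hj : j = j₀
    · subst hj
      exact (hj₀ i).imp_right fun ⟨k, hk, hle⟩ => ⟨k, hk, (hcol j i).trans hle⟩
    · exact Or.inr (exists_cofactor_mul_le w hj i)
  rcases h σ with ⟨i₁, hi₁⟩ | ⟨τ, hτ, hle⟩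
  · refine main (σ i₁) fun i => ?_
    by_cases hi : i = i₁
    · exact Or.inl (hi ▸ hi₁)
    · exact Or.inr ⟨i₁, Ne.symm hi, prod_le_cofactor_mul w rfl⟩
  -- In column `σ i₁` the optimum is attained by two rows, `i₁` through `σ` and `τ.symm (σ i₁)`
  -- through `τ`.
  · obtain ⟨i₁, hi₁⟩ := not_forall.1 (mt Equiv.ext hτ)
    refine main (σ i₁) fun i => Or.inr ?_
    by_cases hi : i = i₁
    · refine ⟨τ.symm (σ i₁), fun e => hi₁ ?_, hle.trans
        (prod_le_cofactor_mul w (τ.apply_symm_apply _))⟩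
      rw [← hi, ← e, Equiv.apply_symm_apply, e, hi]
    · exact ⟨i₁, Ne.symm hi, prod_le_cofactor_mul w rfl⟩

/-! ### Rank and dependence of all rows -/

theorem tropDependent_comp_equiv_iff {ι ι' κ : Type*} [Fintype ι] [Fintype ι'] (e : ι' ≃ ι)
    (v : ι → κ → ExtTrop) : TropDependent (fun i => v (e i)) ↔ TropDependent v := by
  simp only [tropDependent_iff]
  constructor
  · rintro ⟨α, ⟨i, hi⟩, h⟩
    refine ⟨fun i => α (e.symm i), ⟨e i, by simpa using hi⟩, fun j i => ?_⟩
    have := h j (e.symm i)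
    simp only [Equiv.apply_symm_apply] at this
    refine this.imp_right (Or.imp_right fun ⟨k, hk, hle⟩ => ⟨e k, fun he => hk ?_, ?_⟩)
    · rw [← he, Equiv.symm_apply_apply]
    · simpa using hle
  · rintro ⟨α, ⟨i, hi⟩, h⟩
    refine ⟨fun i => α (e i), ⟨e.symm i, by simpa using hi⟩, fun j i => ?_⟩
    refine (h j (e i)).imp_right (Or.imp_right fun ⟨k, hk, hle⟩ => ⟨e.symm k, fun he => hk ?_, ?_⟩)
    · rw [← he, Equiv.apply_symm_apply]
    · simpa using hle

theorem tropRank_lt_iff {m n : ℕ} (A : Matrix (Fin m) (Fin n) ExtTrop) :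
    tropRank A < m ↔ TropDependent fun i => A i := by
  classical
  have huniv : TropDependent (fun i : (Finset.univ : Finset (Fin m)) => A.row i) ↔
      TropDependent fun i => A i :=
    tropDependent_comp_equiv_iff (Equiv.subtypeUnivEquiv Finset.mem_univ) fun i => A i
  -- Ensures that the supremum defining the rank is attained.
  have hempty : TropIndependent fun i : (∅ : Finset (Fin m)) => A.row i := by
    rintro ⟨-, -, ⟨⟨i, hi⟩, -⟩, -⟩
    exact absurd hi (Finset.notMem_empty i)
  unfold tropRank
  constructor
  · intro h
    by_contra hdep
    rw [← huniv] at hdep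
    refine h.not_ge ?_
    have := Finset.le_sup (f := Finset.card) (Finset.mem_filter
      (p := fun s : Finset (Fin m) => TropIndependent fun i : s => A.row i).2
      ⟨Finset.mem_univ (Finset.univ : Finset (Fin m)), hdep⟩)
    simpa using this
  · intro hdep
    obtain ⟨s, hs, he⟩ := Finset.exists_mem_eq_sup
      (Finset.univ.filter fun s : Finset (Fin m) => TropIndependent fun i : s => A.row i)
      ⟨∅, Finset.mem_filter.2 ⟨Finset.mem_univ _, hempty⟩⟩ Finset.card
    rw [he]
    refine lt_of_le_of_ne (by simpa using Finset.card_le_univ s) fun hcard => ?_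
    obtain rfl : s = Finset.univ := (Finset.card_eq_iff_eq_univ s).1 (by simpa using hcard)
    exact (Finset.mem_filter.1 hs).2 (huniv.2 hdep)

end ExtTrop

theorem mainTheorem1 (n : ℕ) (A : Matrix (Fin n) (Fin n) ExtTrop) :
    ExtTrop.tropRank A < n ↔ ExtTrop.TropSingular A := by
  rw [ExtTrop.tropRank_lt_iff]
  exact ⟨ExtTrop.tropSingular_of_tropDependent, ExtTrop.tropDependent_of_tropSingular⟩
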